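/- Conventions. Let $\mathbb X$ be a Cartesian left additive category: a category with chosen finite products (terminal object $\top$, projections $\pi_0,\pi_1$, pairing $\langle-,-\rangle$) whose hom-sets are commutative monoids, such that $(f+g)\circ a=f\circ a+g\circ a$, $0\circ a=0$, and post-composition with a projection preserves sums and zeros. Put $\iota_0=\langle 1,0\rangle$ and $\iota_1=\langle 0,1\rangle$. A *differential combinator* sends $f:A\to B$ to $\mathsf D[f]:A\times A\to B$ such that: [CD.1] $\mathsf D[f+g]=\mathsf D[f]+\mathsf D[g]$, $\mathsf D[0]=0$; [CD.2] $\mathsf D[f]\circ\langle a,b+c\rangle=\mathsf D[f]\circ\langle a,b\rangle+\mathsf D[f]\circ\langle a,c\rangle$, $\mathsf D[f]\circ\langle a,0\rangle=0$; [CD.3] $\mathsf D[1]=\pi_1$, $\mathsf D[\pi_j]=\pi_j\circ\pi_1$; [CD.4] $\mathsf D[\langle f,g\rangle]=\langle\mathsf D[f],\mathsf D[g]\rangle$; [CD.5] $\mathsf D[g\circ f]=\mathsf D[g]\circ\langle f\circ\pi_0,\mathsf D[f]\rangle$; [CD.6] $\mathsf D[\mathsf D[f]]\circ\langle\langle a,b\rangle,\langle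 0,c\rangle\rangle=\mathsf D[f]\circ\langle a,c\rangle$; [CD.7] $\mathsf D[\mathsf D[f]]\circ\langle\langle a,b\rangle,\langle c,0\rangle\rangle=\mathsf D[\mathsf D[f]]\circ\langle\langle a,c\rangle,\langle b,0\rangle\rangle$. A map $f:A\to B$ is *linear* if $\mathsf D[f]\circ\langle a,b\rangle=f\circ b$. A map $f:A\times B\to C$ is *linear in its second argument* if $\mathsf D[f]\circ\langle\langle a,b\rangle,\langle 0,d\rangle\rangle=f\circ\langle a,d\rangle$, *linear in its first argument* if $\mathsf D[f]\circ\langle\langle a,b\rangle,\langle c,0\rangle\rangle=f\circ\langle c,b\rangle$, and *bilinear* if both hold. A *reverse differential combinator* sends $f:A\to B$ to $\mathsf R[f]:A\times B\to A$ such that: [RD.1] $\mathsf R[f+g]=\mathsf R[f]+\mathsf R[g]$, $\mathsf R[0]=0$; [RD.2] $\mathsf R[f]\circ\langle a,b+c\rangle=\mathsf R[f]\circ\langle a,b\rangle+\mathsf R[f]\circ\langle a,c\rangle$, $\mathsf R[f]\circ\langle a,0\rangle=0$; [RD.3] $\mathsf R[1]=\pi_1$, $\mathsf R[\pi_j]=\iota_j\circ\pi_1$;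 [RD.4] $\mathsf R[\langle f,g\rangle]=\mathsf R[f]\circ(1\times\pi_0)+\mathsf R[g]\circ(1\times\pi_1)$; [RD.5] $\mathsf R[g\circ f]=\mathsf R[f]\circ\langle\pi_0,\mathsf R[g]\circ(f\times1)\rangle$; and, writing $\mathsf D[f]:=\pi_1\circ\mathsf R[\mathsf R[f]]\circ(\langle1,0\rangle\times1)$, [RD.6] $\mathsf D[\mathsf R[f]]\circ\langle\langle a,b\rangle,\langle0,c\rangle\rangle=\mathsf R[f]\circ\langle a,c\rangle$; [RD.7] $\mathsf D[\mathsf D[f]]\circ\langle\langle a,b\rangle,\langle c,d\rangle\rangle=\mathsf D[\mathsf D[f]]\circ\langle\langle a,c\rangle,\langle b,d\rangle\rangle$. This $\mathsf D$ is a differential combinator, the *induced* one. A *contextual linear dagger* for $\mathsf D$ sends each $f:A\times B\to C$ linear in its second argument to $f^{\dagger[A]}:A\times C\to B$, again linear in its second argument, such that $f^{\dagger[A]\dagger[A]}=f$, $\pi_1^{\dagger[A]}=\pi_1$, $(g\circ\langle\pi_0,f\rangle)^{\dagger[A]}=f^{\dagger[A]}\circ\langle\pi_0,g^{\dagger[A]}\rangle$,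 $(\pi_j\circ\pi_1)^{\dagger[A]}=\iota_j\circ\pi_1$, and $(f\circ(h\times1))^{\dagger[A']}=f^{\dagger[A]}\circ(h\times1)$ for all $h:A'\to A$. For a linear map $f:A\to B$ put $f^\dagger:=(f\circ\pi_1)^{\dagger[\top]}\circ\langle !,1_B\rangle:B\to A$. A differential combinator is *linearly closed* if it is equipped with objects $\mathcal L(A,B)$ and bilinear maps $\varepsilon_\ell:\mathcal L(A,B)\times A\to B$ such that for each $f:A\times B\to C$ linear in its second argument there is a unique $\lambda_\ell(f):A\to\mathcal L(B,C)$ with $f=\varepsilon_\ell\circ(\lambda_\ell(f)\times1_B)$. Then put $\mathbf J(f):=\lambda_\ell(\mathsf D[f])$; $p_f:=\lambda_\ell(f\circ\pi_1):\top\to\mathcal L(A,B)$ for linear $f:A\to B$; and let $\odot:\mathcal L(B,C)\times\mathcal L(A,B)\to\mathcal L(A,C)$ be the linear curry of $\varepsilon_\ell\circ(1\times\varepsilon_\ell)$. A *linear transpose* is a family of linear maps $\tau:\mathcal L(A,B)\to\mathcal L(B,A)$ with $\tau\circ\tau=1$, $\tau\circ p_{1}=p_{1}$, $\tau\circ p_{\pi_j}=p_{\iota_j}$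 and $\tau\circ\odot=\odot\circ\langle\tau\circ\pi_1,\tau\circ\pi_0\rangle$. A *linearly closed Cartesian reverse differential category* is given by a reverse differential combinator and a linearly closed structure for the induced differential combinator; its *gradient* is $\nabla(f):=\lambda_\ell(\mathsf R[f])$ (the map $\mathsf R[f]$ is linear in its second argument by [RD.6]). Proposition. (1) For each linearly closed Cartesian differential structure on $\mathbb X$, the assignments $(-)^{\dagger[-]}\mapsto\tau=\lambda_\ell(\varepsilon_\ell^{\dagger[\mathcal L(A,B)]})$ and $\tau\mapsto\big(f^{\dagger[A]}=\varepsilon_\ell\circ(\tau\times1)\circ(\lambda_\ell(f)\times1)\big)$ are mutually inverse bijections between contextual linear daggers and linear transposes. (2) Each linearly closed Cartesian reverse differential structure on $\mathbb X$ has exactly one contextual linear dagger (for the induced $\mathsf D$) with $\mathsf R[f]=\mathsf D[f]^{\dagger[A]}$ for all $f:A\to B$. Let $\tau=\lambda_\ell(\varepsilon_\ell^{\dagger[\mathcal L(A,B)]})$ be the corresponding linear transpose. Sending $(\mathsf R,\mathcal L,\varepsilon_\ell)$ to $(\mathsf D,\mathcal L,\varepsilon_\ell,\tau)$ is a bijection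 from the linearly closed Cartesian reverse differential structures on $\mathbb X$ onto the linearly closed Cartesian differential structures on $\mathbb X$ equipped with a linear transpose, and $\mathsf R[f]=\varepsilon_\ell\circ(\tau\times1)\circ(\mathbf J(f)\times1)$. (3) In a linearly closed Cartesian reverse differential category, with this dagger and this $\tau$: (i) $f^{\dagger[A]}=\varepsilon_\ell^{\dagger[\mathcal L(B,C)]}\circ(\lambda_\ell(f)\times1)$ for $f:A\times B\to C$ linear in its second argument; (ii) $\lambda_\ell(f^{\dagger[A]})=\tau\circ\lambda_\ell(f)$ for such $f$; (iii) $\nabla(f)=\tau\circ\mathbf J(f)$; (iv) $\nabla(f+g)=\nabla(f)+\nabla(g)$ and $\nabla(0)=0$; (v) if $f:A\to B$ is linear then $\nabla(f)=p_{f^\dagger}\circ0$, where $0:A\to\top$; (vi) $\nabla(g\circ f)=\odot\circ\langle\nabla(f),\nabla(g)\circ f\rangle$. -/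

import Mathlib

open CategoryTheory MonoidalCategory CartesianMonoidalCategory

universe v u

namespace CartDiff

/-- A left additive category: hom-sets are commutative monoids and pre-composition is additive. -/
class LeftAdditiveCategory (X : Type u) [Category.{v} X] where
  homAddCommMonoid : ∀ A B : X, AddCommMonoid (A ⟶ B)
  comp_add : ∀ {Z A B : X} (a : Z ⟶ A) (f g : A ⟶ B), a ≫ (f + g) = a ≫ f + a ≫ g
  comp_zero : ∀ {Z A : X} (a : Z ⟶ A) (B : X), a ≫ (0 : A ⟶ B) = 0

attribute [reducible, instance] LeftAdditiveCategory.homAddCommMonoid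

/-- A map is additive if post-composition by it preserves the additive structure. -/
structure IsAdditive {X : Type u} [Category.{v} X] [LeftAdditiveCategory X] {A B : X}
    (f : A ⟶ B) : Prop where
  add_comp : ∀ {Z : X} (a b : Z ⟶ A), (a + b) ≫ f = a ≫ f + b ≫ f
  zero_comp : ∀ Z : X, (0 : Z ⟶ A) ≫ f = 0

/-- A Cartesian left additive category: a left additive category with (chosen) finite products
whose projections are additive. -/
class CartesianLeftAdditiveCategory (X : Type u) [Category.{v} X]
    [CartesianMonoidalCategory X] extends LeftAdditiveCategory X where
  fst_additive : ∀ A B : X, IsAdditive (fst A B)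
  snd_additive : ∀ A B : X, IsAdditive (snd A B)

section products

variable {X : Type u} [Category.{v} X] [CartesianMonoidalCategory X]

theorem whiskerRight_eq_lift {A B : X} (f : A ⟶ B) (C : X) :
    f ▷ C = lift (fst A C ≫ f) (snd A C) := by ext <;> simp

theorem whiskerLeft_eq_lift {A B : X} (C : X) (f : A ⟶ B) :
    C ◁ f = lift (fst C A) (snd C A ≫ f) := by ext <;> simp

theorem hom_ext_lift {A B C : X} {f g : A ⊗ B ⟶ C}
    (h : lift (fst A B) (snd A B) ≫ f = lift (fst A B) (snd A B) ≫ g) : f = g := by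
  simpa using h

end products

variable {X : Type u} [Category.{v} X] [CartesianMonoidalCategory X]
  [CartesianLeftAdditiveCategory X]

section basic

theorem comp_add' {Z A B : X} (a : Z ⟶ A) (f g : A ⟶ B) : a ≫ (f + g) = a ≫ f + a ≫ g :=
  LeftAdditiveCategory.comp_add a f g

theorem comp_zero' {Z A B : X} (a : Z ⟶ A) : a ≫ (0 : A ⟶ B) = 0 :=
  LeftAdditiveCategory.comp_zero a B

theorem add_fst {Z A B : X} (a b : Z ⟶ A ⊗ B) :
    (a + b) ≫ fst A B = a ≫ fst A B + b ≫ fst A B :=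
  (CartesianLeftAdditiveCategory.fst_additive A B).add_comp a b

theorem add_snd {Z A B : X} (a b : Z ⟶ A ⊗ B) :
    (a + b) ≫ snd A B = a ≫ snd A B + b ≫ snd A B :=
  (CartesianLeftAdditiveCategory.snd_additive A B).add_comp a b

theorem zero_fst {Z A B : X} : (0 : Z ⟶ A ⊗ B) ≫ fst A B = 0 :=
  (CartesianLeftAdditiveCategory.fst_additive A B).zero_comp Z

theorem zero_snd {Z A B : X} : (0 : Z ⟶ A ⊗ B) ≫ snd A B = 0 :=
  (CartesianLeftAdditiveCategory.snd_additive A B).zero_comp Z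

end basic

/-- The injection `⟨1, 0⟩ : A ⟶ A × B`. -/
def inl (A B : X) : A ⟶ A ⊗ B := lift (𝟙 A) 0

/-- The injection `⟨0, 1⟩ : B ⟶ A × B`. -/
def inr (A B : X) : B ⟶ A ⊗ B := lift 0 (𝟙 B)

/-! ### Differential combinators -/

/-- A differential combinator on a Cartesian left additive category. A Cartesian differential
category is a Cartesian left additive category equipped with such a combinator. -/
@[ext]
structure DifferentialCombinator (X : Type u) [Category.{v} X] [CartesianMonoidalCategory X]
    [CartesianLeftAdditiveCategory X] where
  D : ∀ ⦃A B : X⦄, (A ⟶ B) → (A ⊗ A ⟶ B)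
  D_add : ∀ {A B : X} (f g : A ⟶ B), D (f + g) = D f + D g
  D_zero : ∀ A B : X, D (0 : A ⟶ B) = 0
  lift_add_D : ∀ {Z A B : X} (f : A ⟶ B) (a b c : Z ⟶ A),
    lift a (b + c) ≫ D f = lift a b ≫ D f + lift a c ≫ D f
  lift_zero_D : ∀ {Z A B : X} (f : A ⟶ B) (a : Z ⟶ A), lift a 0 ≫ D f = 0
  D_id : ∀ A : X, D (𝟙 A) = snd A A
  D_fst : ∀ A B : X, D (fst A B) = snd (A ⊗ B) (A ⊗ B) ≫ fst A B
  D_snd : ∀ A B : X, D (snd A B) = snd (A ⊗ B) (A ⊗ B) ≫ snd A B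
  D_lift : ∀ {A B C : X} (f : A ⟶ B) (g : A ⟶ C), D (lift f g) = lift (D f) (D g)
  D_comp : ∀ {A B C : X} (f : A ⟶ B) (g : B ⟶ C),
    D (f ≫ g) = lift (fst A A ≫ f) (D f) ≫ D g
  D_D_linear : ∀ {Z A B : X} (f : A ⟶ B) (a b c : Z ⟶ A),
    lift (lift a b) (lift 0 c) ≫ D (D f) = lift a c ≫ D f
  D_D_symm : ∀ {Z A B : X} (f : A ⟶ B) (a b c : Z ⟶ A),
    lift (lift a b) (lift c 0) ≫ D (D f) = lift (lift a c) (lift b 0) ≫ D (D f)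

namespace DifferentialCombinator

variable (𝒟 : DifferentialCombinator X)

/-- Linear maps: `D[f] ∘ ⟨a, b⟩ = f ∘ b`. -/
def IsLinear {A B : X} (f : A ⟶ B) : Prop :=
  ∀ ⦃Z : X⦄ (a b : Z ⟶ A), lift a b ≫ 𝒟.D f = b ≫ f

/-- Maps `A × B ⟶ C` that are linear in their first argument. -/
def IsLinearFst {A B C : X} (f : A ⊗ B ⟶ C) : Prop :=
  ∀ ⦃Z : X⦄ (a : Z ⟶ A) (b : Z ⟶ B) (c : Z ⟶ A),
    lift (lift a b) (lift c 0) ≫ 𝒟.D f = lift c b ≫ f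

/-- Maps `A × B ⟶ C` that are linear in their second argument. -/
def IsLinearSnd {A B C : X} (f : A ⊗ B ⟶ C) : Prop :=
  ∀ ⦃Z : X⦄ (a : Z ⟶ A) (b d : Z ⟶ B),
    lift (lift a b) (lift 0 d) ≫ 𝒟.D f = lift a d ≫ f

/-- Bilinear maps. -/
def IsBilinear {A B C : X} (f : A ⊗ B ⟶ C) : Prop :=
  𝒟.IsLinearFst f ∧ 𝒟.IsLinearSnd f

theorem lift_comp {Z A B C : X} (f : A ⟶ B) (g : B ⟶ C) (a b : Z ⟶ A) :
    lift a b ≫ 𝒟.D (f ≫ g) = lift (a ≫ f) (lift a b ≫ 𝒟.D f) ≫ 𝒟.D g := by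
  rw [𝒟.D_comp, ← Category.assoc, comp_lift]; simp

theorem lift_fst' {Z A B : X} (a b : Z ⟶ A ⊗ B) :
    lift a b ≫ 𝒟.D (fst A B) = b ≫ fst A B := by simp [𝒟.D_fst]

theorem lift_snd' {Z A B : X} (a b : Z ⟶ A ⊗ B) :
    lift a b ≫ 𝒟.D (snd A B) = b ≫ snd A B := by simp [𝒟.D_snd]

theorem lift_id {Z A : X} (a b : Z ⟶ A) : lift a b ≫ 𝒟.D (𝟙 A) = b := by simp [𝒟.D_id]

theorem lift_lift {Z A B C : X} (f : A ⟶ B) (g : A ⟶ C) (a b : Z ⟶ A) :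
    lift a b ≫ 𝒟.D (lift f g) = lift (lift a b ≫ 𝒟.D f) (lift a b ≫ 𝒟.D g) := by
  rw [𝒟.D_lift, comp_lift]

theorem lift_zero {Z A B : X} (a b : Z ⟶ A) : lift a b ≫ 𝒟.D (0 : A ⟶ B) = 0 := by
  rw [𝒟.D_zero, comp_zero']

theorem D_isLinearSnd {A B : X} (f : A ⟶ B) : 𝒟.IsLinearSnd (𝒟.D f) :=
  fun _ a b d => 𝒟.D_D_linear f a b d

theorem id_isLinear (A : X) : 𝒟.IsLinear (𝟙 A) := fun _ a b => by simp [𝒟.lift_id]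

theorem fst_isLinear (A B : X) : 𝒟.IsLinear (fst A B) := fun _ a b => 𝒟.lift_fst' a b

theorem snd_isLinear (A B : X) : 𝒟.IsLinear (snd A B) := fun _ a b => 𝒟.lift_snd' a b

theorem inl_isLinear (A B : X) : 𝒟.IsLinear (inl A B) := fun _ a b => by
  simp [inl, 𝒟.lift_lift, 𝒟.lift_id, 𝒟.lift_zero, comp_lift, comp_zero']

theorem inr_isLinear (A B : X) : 𝒟.IsLinear (inr A B) := fun _ a b => by
  simp [inr, 𝒟.lift_lift, 𝒟.lift_id, 𝒟.lift_zero, comp_lift, comp_zero']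

variable {𝒟}

theorem IsLinear.snd_comp {B C : X} {f : B ⟶ C} (hf : 𝒟.IsLinear f) (A : X) :
    𝒟.IsLinearSnd (snd A B ≫ f) := fun _ a b d => by
  rw [𝒟.lift_comp, 𝒟.lift_snd', hf]; simp

/-- Identities of the category of maps that are linear in context `A`. -/
theorem snd_isLinearSnd (A B : X) : 𝒟.IsLinearSnd (snd A B) := fun _ a b d => by
  rw [𝒟.lift_snd']; simp

/-- Composition of the category of maps that are linear in context `A`. -/
theorem IsLinearSnd.comp {A B C E : X} {f : A ⊗ B ⟶ C} {g : A ⊗ C ⟶ E}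
    (hf : 𝒟.IsLinearSnd f) (hg : 𝒟.IsLinearSnd g) :
    𝒟.IsLinearSnd (lift (fst A B) f ≫ g) := fun _ a b d => by
  rw [𝒟.lift_comp, 𝒟.lift_lift, hf, 𝒟.lift_fst', comp_lift]
  simp only [lift_fst]
  rw [← Category.assoc, comp_lift, hg, lift_fst]

/-- Change of context along `h`. -/
theorem IsLinearSnd.subst {A A' B C : X} {f : A ⊗ B ⟶ C} (hf : 𝒟.IsLinearSnd f)
    (h : A' ⟶ A) : 𝒟.IsLinearSnd ((h ▷ B) ≫ f) := fun _ a b d => by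
  have h0 : lift a (0 : _ ⟶ A') ≫ 𝒟.D h = 0 := 𝒟.lift_zero_D h a
  rw [whiskerRight_eq_lift, 𝒟.lift_comp, 𝒟.lift_lift, 𝒟.lift_snd', 𝒟.lift_comp, 𝒟.lift_fst',
    comp_lift]
  simp only [lift_fst, lift_snd, lift_fst_assoc, h0]
  rw [← Category.assoc, comp_lift, hf]; simp

end DifferentialCombinator

/-! ### Contextual linear daggers -/

open DifferentialCombinator in
/-- A contextual linear dagger: for every context `A`, the category of maps which are linear in
context `A` (a map from `B` to `C` is a map `A × B ⟶ C` linear in its second argument, the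
identity is the second projection, and composition is `g ∘ ⟨π₀, f⟩`) is a dagger category with
finite dagger biproducts, and the daggers are preserved by change of context. -/
@[ext]
structure ContextualLinearDagger (𝒟 : DifferentialCombinator X) where
  dag : ∀ ⦃A B C : X⦄ (f : A ⊗ B ⟶ C), 𝒟.IsLinearSnd f → (A ⊗ C ⟶ B)
  dag_linear : ∀ {A B C : X} (f : A ⊗ B ⟶ C) (hf : 𝒟.IsLinearSnd f),
    𝒟.IsLinearSnd (dag f hf)
  dag_dag : ∀ {A B C : X} (f : A ⊗ B ⟶ C) (hf : 𝒟.IsLinearSnd f),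
    dag (dag f hf) (dag_linear f hf) = f
  dag_id : ∀ A B : X, dag (snd A B) (snd_isLinearSnd A B) = snd A B
  dag_comp : ∀ {A B C E : X} (f : A ⊗ B ⟶ C) (g : A ⊗ C ⟶ E) (hf : 𝒟.IsLinearSnd f)
    (hg : 𝒟.IsLinearSnd g),
    dag (lift (fst A B) f ≫ g) (hf.comp hg) = lift (fst A E) (dag g hg) ≫ dag f hf
  dag_fst : ∀ A B C : X, dag (snd A (B ⊗ C) ≫ fst B C) ((𝒟.fst_isLinear B C).snd_comp A) =
    snd A B ≫ inl B C
  dag_snd : ∀ A B C : X, dag (snd A (B ⊗ C) ≫ snd B C) ((𝒟.snd_isLinear B C).snd_comp A) =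
    snd A C ≫ inr B C
  dag_subst : ∀ {A A' B C : X} (f : A ⊗ B ⟶ C) (hf : 𝒟.IsLinearSnd f) (h : A' ⟶ A),
    dag ((h ▷ B) ≫ f) (hf.subst h) = (h ▷ C) ≫ dag f hf

namespace ContextualLinearDagger

variable {𝒟 : DifferentialCombinator X} (𝒹 : ContextualLinearDagger 𝒟)

/-- The dagger of a linear map `f : A ⟶ B`: the dagger in the terminal context. -/
def linDag {A B : X} (f : A ⟶ B) (hf : 𝒟.IsLinear f) : B ⟶ A :=
  lift (toUnit B) (𝟙 B) ≫ 𝒹.dag (snd (𝟙_ X) A ≫ f) (hf.snd_comp _)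

theorem linDag_isLinear {A B : X} (f : A ⟶ B) (hf : 𝒟.IsLinear f) :
    𝒟.IsLinear (𝒹.linDag f hf) := fun _ a b => by
  rw [linDag, 𝒟.lift_comp, 𝒟.lift_lift, 𝒟.lift_id, comp_lift,
    toUnit_unique (lift a b ≫ 𝒟.D (toUnit B)) 0, Category.comp_id, 𝒹.dag_linear,
    ← Category.assoc, comp_lift, Category.comp_id, toUnit_unique (a ≫ toUnit B)]

end ContextualLinearDagger

/-! ### Reverse differential combinators -/

/-- The derivative induced by an operator `R` as in a reverse differential combinator:
`D[f] = π₁ ∘ R[R[f]] ∘ (⟨1, 0⟩ × 1)`. -/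
def inducedD (R : ∀ ⦃A B : X⦄, (A ⟶ B) → (A ⊗ B ⟶ A)) ⦃A B : X⦄ (f : A ⟶ B) : A ⊗ A ⟶ B :=
  (inl A B ▷ A) ≫ R (R f) ≫ snd A B

/-- A reverse differential combinator on a Cartesian left additive category. A Cartesian reverse
differential category is a Cartesian left additive category equipped with such a combinator. The
last two axioms speak of third and fourth reverse derivatives, written through `inducedD`. -/
@[ext]
structure ReverseDifferentialCombinator (X : Type u) [Category.{v} X]
    [CartesianMonoidalCategory X] [CartesianLeftAdditiveCategory X] where
  R : ∀ ⦃A B : X⦄, (A ⟶ B) → (A ⊗ B ⟶ A)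
  R_add : ∀ {A B : X} (f g : A ⟶ B), R (f + g) = R f + R g
  R_zero : ∀ A B : X, R (0 : A ⟶ B) = 0
  lift_add_R : ∀ {Z A B : X} (f : A ⟶ B) (a : Z ⟶ A) (b c : Z ⟶ B),
    lift a (b + c) ≫ R f = lift a b ≫ R f + lift a c ≫ R f
  lift_zero_R : ∀ {Z A B : X} (f : A ⟶ B) (a : Z ⟶ A), lift a 0 ≫ R f = 0
  R_id : ∀ A : X, R (𝟙 A) = snd A A
  R_fst : ∀ A B : X, R (fst A B) = snd (A ⊗ B) A ≫ inl A B
  R_snd : ∀ A B : X, R (snd A B) = snd (A ⊗ B) B ≫ inr A B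
  R_lift : ∀ {A B C : X} (f : A ⟶ B) (g : A ⟶ C),
    R (lift f g) = (A ◁ fst B C) ≫ R f + (A ◁ snd B C) ≫ R g
  R_comp : ∀ {A B C : X} (f : A ⟶ B) (g : B ⟶ C),
    R (f ≫ g) = lift (fst A C) ((f ▷ C) ≫ R g) ≫ R f
  R_linear : ∀ {Z A B : X} (f : A ⟶ B) (a : Z ⟶ A) (b c : Z ⟶ B),
    lift (lift a b) (lift 0 c) ≫ inducedD R (R f) = lift a c ≫ R f
  R_symm : ∀ {Z A B : X} (f : A ⟶ B) (a b c d : Z ⟶ A),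
    lift (lift a b) (lift c d) ≫ inducedD R (inducedD R f) =
      lift (lift a c) (lift b d) ≫ inducedD R (inducedD R f)

namespace ReverseDifferentialCombinator

variable (𝓡 : ReverseDifferentialCombinator X)

theorem lift_comp {Z A B C : X} (f : A ⟶ B) (g : B ⟶ C) (a : Z ⟶ A) (c : Z ⟶ C) :
    lift a c ≫ 𝓡.R (f ≫ g) = lift a (lift (a ≫ f) c ≫ 𝓡.R g) ≫ 𝓡.R f := by
  rw [𝓡.R_comp, ← Category.assoc, comp_lift, lift_fst, ← Category.assoc, lift_whiskerRight]

theorem lift_fst' {Z A B : X} (a : Z ⟶ A ⊗ B) (c : Z ⟶ A) :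
    lift a c ≫ 𝓡.R (fst A B) = lift c 0 := by
  rw [𝓡.R_fst, lift_snd_assoc, inl, comp_lift, Category.comp_id, comp_zero']

theorem lift_snd' {Z A B : X} (a : Z ⟶ A ⊗ B) (c : Z ⟶ B) :
    lift a c ≫ 𝓡.R (snd A B) = lift 0 c := by
  rw [𝓡.R_snd, lift_snd_assoc, inr, comp_lift, Category.comp_id, comp_zero']

theorem lift_id {Z A : X} (a b : Z ⟶ A) : lift a b ≫ 𝓡.R (𝟙 A) = b := by simp [𝓡.R_id]

theorem lift_zero {Z A B : X} (a : Z ⟶ A) (b : Z ⟶ B) :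
    lift a b ≫ 𝓡.R (0 : A ⟶ B) = 0 := by
  rw [𝓡.R_zero, comp_zero']

theorem lift_lift {Z A B C : X} (f : A ⟶ B) (g : A ⟶ C) (a : Z ⟶ A) (b : Z ⟶ B ⊗ C) :
    lift a b ≫ 𝓡.R (lift f g) =
      lift a (b ≫ fst B C) ≫ 𝓡.R f + lift a (b ≫ snd B C) ≫ 𝓡.R g := by
  rw [𝓡.R_lift, comp_add', ← Category.assoc, ← Category.assoc, lift_whiskerLeft,
    lift_whiskerLeft]

theorem lift_inducedD {Z A B : X} (f : A ⟶ B) (a b : Z ⟶ A) :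
    lift a b ≫ inducedD 𝓡.R f = lift (lift a 0) b ≫ 𝓡.R (𝓡.R f) ≫ snd A B := by
  rw [inducedD, ← Category.assoc, lift_whiskerRight, inl, comp_lift, Category.comp_id,
    comp_zero']

theorem lift_add_lift {Z A B : X} (a a' : Z ⟶ A) (b b' : Z ⟶ B) :
    lift a b + lift a' b' = lift (a + a') (b + b') := by
  ext <;> simp [add_fst, add_snd]

theorem lift_zero_zero (Z A B : X) : lift (0 : Z ⟶ A) (0 : Z ⟶ B) = 0 := by
  ext <;> simp [zero_fst, zero_snd]

theorem ind_id (A : X) : inducedD 𝓡.R (𝟙 A) = snd A A := by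
  apply hom_ext_lift
  rw [𝓡.lift_inducedD, 𝓡.R_id, ← Category.assoc, 𝓡.lift_snd']; simp

theorem ind_fst (A B : X) : inducedD 𝓡.R (fst A B) = snd (A ⊗ B) (A ⊗ B) ≫ fst A B := by
  apply hom_ext_lift
  rw [𝓡.lift_inducedD, 𝓡.R_fst, ← Category.assoc, 𝓡.lift_comp, 𝓡.lift_snd', inl, 𝓡.lift_lift,
    𝓡.lift_id, 𝓡.lift_zero]
  simp

theorem ind_snd (A B : X) : inducedD 𝓡.R (snd A B) = snd (A ⊗ B) (A ⊗ B) ≫ snd A B := by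
  apply hom_ext_lift
  rw [𝓡.lift_inducedD, 𝓡.R_snd, ← Category.assoc, 𝓡.lift_comp, 𝓡.lift_snd', inr, 𝓡.lift_lift,
    𝓡.lift_id, 𝓡.lift_zero]
  simp

theorem ind_lift {A B C : X} (f : A ⟶ B) (g : A ⟶ C) :
    inducedD 𝓡.R (lift f g) = lift (inducedD 𝓡.R f) (inducedD 𝓡.R g) := by
  apply hom_ext_lift
  rw [comp_lift, 𝓡.lift_inducedD, 𝓡.lift_inducedD, 𝓡.lift_inducedD, 𝓡.R_lift, 𝓡.R_add,
    ← Category.assoc, comp_add', add_snd]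
  simp only [whiskerLeft_eq_lift, 𝓡.lift_comp, 𝓡.lift_lift, 𝓡.lift_fst', 𝓡.lift_snd',
    lift_add_lift, add_zero, zero_add, lift_snd, comp_lift, lift_fst, lift_snd_assoc, zero_fst,
    zero_snd, Category.assoc]

theorem ind_comp {A B C : X} (f : A ⟶ B) (g : B ⟶ C) :
    inducedD 𝓡.R (f ≫ g) = lift (fst A A ≫ f) (inducedD 𝓡.R f) ≫ inducedD 𝓡.R g := by
  apply hom_ext_lift
  rw [← Category.assoc, comp_lift, 𝓡.lift_inducedD, 𝓡.lift_inducedD, 𝓡.lift_inducedD, 𝓡.R_comp,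
    ← Category.assoc]
  simp only [whiskerRight_eq_lift, 𝓡.lift_comp, 𝓡.lift_lift, 𝓡.lift_fst', 𝓡.lift_snd',
    lift_add_lift, add_zero, zero_add, lift_snd, comp_lift, lift_fst, lift_fst_assoc,
    𝓡.lift_zero_R, Category.assoc, ← Category.assoc (lift _ _) (lift _ _)]

/-- The induced Cartesian differential structure of a Cartesian reverse differential category. -/
def toDiff : DifferentialCombinator X where
  D := inducedD 𝓡.R
  D_add f g := by
    apply hom_ext_lift
    simp only [comp_add', 𝓡.lift_inducedD, 𝓡.R_add, ← Category.assoc, add_snd]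
  D_zero A B := by
    apply hom_ext_lift
    simp only [𝓡.lift_inducedD, 𝓡.R_zero, comp_zero', zero_snd]
  lift_add_D f a b c := by
    simp only [𝓡.lift_inducedD, ← Category.assoc, 𝓡.lift_add_R, add_snd]
  lift_zero_D f a := by
    simp only [𝓡.lift_inducedD, ← Category.assoc, 𝓡.lift_zero_R, zero_snd]
  D_id := 𝓡.ind_id
  D_fst := 𝓡.ind_fst
  D_snd := 𝓡.ind_snd
  D_lift := 𝓡.ind_lift
  D_comp := 𝓡.ind_comp
  D_D_linear {Z A B} f a b c := by
    have e : inducedD 𝓡.R f =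
        lift (lift (fst A A) 0) (snd A A) ≫ 𝓡.R (𝓡.R f) ≫ snd A B := by
      rw [← 𝓡.lift_inducedD, lift_fst_snd, Category.id_comp]
    have z : inducedD 𝓡.R (0 : A ⊗ A ⟶ B) = 0 := by
      apply hom_ext_lift
      simp only [𝓡.lift_inducedD, 𝓡.R_zero, comp_zero', zero_snd]
    rw [𝓡.lift_inducedD f a c, e]
    simp only [𝓡.ind_comp, 𝓡.ind_lift, 𝓡.ind_fst, 𝓡.ind_snd, z, ← Category.assoc, comp_lift,
      lift_fst, lift_snd, comp_zero', 𝓡.R_linear, lift_zero_zero]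
  D_D_symm f a b c := 𝓡.R_symm f a b c 0

theorem R_isLinearSnd {A B : X} (f : A ⟶ B) : 𝓡.toDiff.IsLinearSnd (𝓡.R f) :=
  fun _ a b d => 𝓡.R_linear f a b d

end ReverseDifferentialCombinator

/-! ### Linearly closed categories -/

/-- A linearly closed structure on a Cartesian differential category: internal linear homs and
bilinear evaluation maps such that maps linear in their second argument can be curried uniquely. -/
structure LinearlyClosedStructure (𝒟 : DifferentialCombinator X) where
  hom : X → X → X
  ev : ∀ A B : X, hom A B ⊗ A ⟶ B
  ev_bilinear : ∀ A B : X, 𝒟.IsBilinear (ev A B)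
  existsUnique_curry : ∀ {A B C : X} (f : A ⊗ B ⟶ C), 𝒟.IsLinearSnd f →
    ∃! g : A ⟶ hom B C, f = (g ▷ B) ≫ ev B C

/-- The structure of a linearly closed Cartesian differential category on a Cartesian left
additive category. -/
structure LinearlyClosedCDC (X : Type u) [Category.{v} X] [CartesianMonoidalCategory X]
    [CartesianLeftAdditiveCategory X] where
  diff : DifferentialCombinator X
  closed : LinearlyClosedStructure diff

/-- The structure of a linearly closed Cartesian reverse differential category on a Cartesian
left additive category: the induced Cartesian differential structure is linearly closed. -/
structure LinearlyClosedCRDC (X : Type u) [Category.{v} X] [CartesianMonoidalCategory X]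
    [CartesianLeftAdditiveCategory X] where
  rev : ReverseDifferentialCombinator X
  closed : LinearlyClosedStructure rev.toDiff

namespace LinearlyClosedCDC

variable (K : LinearlyClosedCDC X)

/-- The internal linear hom `L(A, B)`. -/
abbrev hom (A B : X) : X := K.closed.hom A B

/-- The evaluation map `L(A, B) × A ⟶ B`. -/
abbrev ev (A B : X) : K.hom A B ⊗ A ⟶ B := K.closed.ev A B

theorem ev_isLinearSnd (A B : X) : K.diff.IsLinearSnd (K.ev A B) := (K.closed.ev_bilinear A B).2

/-- The linear curry of a map which is linear in its second argument. -/
noncomputable def curry {A B C : X} (f : A ⊗ B ⟶ C) (hf : K.diff.IsLinearSnd f) :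
    A ⟶ K.hom B C :=
  (K.closed.existsUnique_curry f hf).choose

/-- The Jacobian, i.e. the linear curry of the derivative. -/
noncomputable def jacobian {A B : X} (f : A ⟶ B) : A ⟶ K.hom A B :=
  K.curry (K.diff.D f) (K.diff.D_isLinearSnd f)

/-- The point `p_f : ⊤ ⟶ L(A, B)` of a linear map `f`, i.e. the linear curry of `f ∘ π₁`. -/
noncomputable def point {A B : X} (f : A ⟶ B) (hf : K.diff.IsLinear f) : 𝟙_ X ⟶ K.hom A B :=
  K.curry (snd (𝟙_ X) A ≫ f) (hf.snd_comp _)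

theorem compose_aux (A B C : X) : K.diff.IsLinearSnd
    ((α_ (K.hom B C) (K.hom A B) A).hom ≫ (K.hom B C ◁ K.ev A B) ≫ K.ev B C) := by
  intro Z a b d
  have e : (α_ (K.hom B C) (K.hom A B) A).hom ≫ (K.hom B C ◁ K.ev A B) =
      lift (fst _ A ≫ fst _ _) ((snd _ _ ▷ A) ≫ K.ev A B) := by
    rw [whiskerLeft_eq_lift, comp_lift, associator_hom_fst, ← Category.assoc]
    congr 2
    ext <;> simp
  have h1 := (K.ev_isLinearSnd A B).subst (snd (K.hom B C) (K.hom A B)) a b d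
  rw [← Category.assoc, e, K.diff.lift_comp, K.diff.lift_lift, h1, K.diff.lift_comp,
    K.diff.lift_fst', K.diff.lift_fst', lift_fst, zero_fst, comp_lift, K.ev_isLinearSnd]
  simp only [← Category.assoc, comp_lift, lift_fst]

/-- Internal composition `L(B, C) × L(A, B) ⟶ L(A, C)`. -/
noncomputable def compose (A B C : X) : K.hom B C ⊗ K.hom A B ⟶ K.hom A C :=
  K.curry ((α_ (K.hom B C) (K.hom A B) A).hom ≫ (K.hom B C ◁ K.ev A B) ≫ K.ev B C)
    (K.compose_aux A B C)

end LinearlyClosedCDC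

/-- A linear transpose on a linearly closed Cartesian differential category. -/
@[ext]
structure LinearTranspose (K : LinearlyClosedCDC X) where
  tr : ∀ A B : X, K.hom A B ⟶ K.hom B A
  tr_linear : ∀ A B : X, K.diff.IsLinear (tr A B)
  tr_tr : ∀ A B : X, tr A B ≫ tr B A = 𝟙 (K.hom A B)
  point_id_tr : ∀ A : X, K.point (𝟙 A) (K.diff.id_isLinear A) ≫ tr A A =
    K.point (𝟙 A) (K.diff.id_isLinear A)
  point_fst_tr : ∀ A B : X, K.point (fst A B) (K.diff.fst_isLinear A B) ≫ tr (A ⊗ B) A =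
    K.point (inl A B) (K.diff.inl_isLinear A B)
  point_snd_tr : ∀ A B : X, K.point (snd A B) (K.diff.snd_isLinear A B) ≫ tr (A ⊗ B) B =
    K.point (inr A B) (K.diff.inr_isLinear A B)
  compose_tr : ∀ A B C : X, K.compose A B C ≫ tr A C =
    lift (snd (K.hom B C) (K.hom A B) ≫ tr A B) (fst (K.hom B C) (K.hom A B) ≫ tr B C) ≫
      K.compose C B A

namespace LinearlyClosedCRDC

variable (S : LinearlyClosedCRDC X)

/-- The underlying linearly closed Cartesian differential category. -/
def toCDC : LinearlyClosedCDC X where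
  diff := S.rev.toDiff
  closed := S.closed

/-- The gradient, i.e. the linear curry of the reverse derivative. -/
noncomputable def gradient {A B : X} (f : A ⟶ B) : A ⟶ S.toCDC.hom B A :=
  S.toCDC.curry (S.rev.R f) (S.rev.R_isLinearSnd f)

end LinearlyClosedCRDC

end CartDiff

open CartDiff

/-! Three kinds of data are matched in pairs. A reverse combinator and a contextual dagger determine
each other by `R[f] = D[f]^†` and `f^† = π₁ ∘ R[f] ∘ (⟨1,0⟩ × 1)`. The link is `dag_D_snd`:
precomposing `D[f]` with the injection of the second argument gives back `f` when `f` is linear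
there, so the second component of `D[f]^†` is `f^†`. Applied to `D[f]^†` in place of `f`, it shows
that the combinator built from a dagger induces the original `D`; in the other direction it shows
that the dagger is unique. The dagger biproduct axioms force the dagger to be additive (`dag_lift`,
`dag_add`), which gives [RD.1] and [RD.4]. A contextual dagger and a transpose determine each other
because every map linear in its second argument is a change of context of the evaluation map. Hence
the dagger is fixed by its value on evaluation, and currying turns composition in context into
internal composition (`curry_dag`, `curry_comp`). The delicate point is that the transpose is
linear, since a dagger says nothing about derivatives in the context variable. Linearity follows
from the algebra alone (`isLinear_of_antiinvolution`). Let `T` be the derivative of `τ` at zero.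
Differentiating `τ(m ∘ l) = τ(l) ∘ τ(m)` gives `T(m ∘ l) = τ(l) ∘ T(m) = T(l) ∘ τ(m)`. With `u =
T(1)` this yields `T(l) = τ(l) ∘ u` and `u ∘ τ(u) = T(u) = 1`, so `τ(l) = T(l) ∘ τ(u)`, which is
linear in `l`. -/

namespace CartDiff

/-! ### Computation with generalized elements -/

section products

variable {X : Type u} [Category.{v} X] [CartesianMonoidalCategory X]

theorem hom_ext_lift_elements {A B C : X} {f g : A ⊗ B ⟶ C}
    (h : ∀ ⦃Z : X⦄ (a : Z ⟶ A) (b : Z ⟶ B), lift a b ≫ f = lift a b ≫ g) : f = g :=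
  hom_ext_lift (h _ _)

theorem lift_lift_fst_comp {Z A B C E : X} (a : Z ⟶ A) (b : Z ⟶ B) (f : A ⊗ B ⟶ C)
    (g : A ⊗ C ⟶ E) : lift a b ≫ lift (fst A B) f ≫ g = lift a (lift a b ≫ f) ≫ g := by
  rw [← Category.assoc, comp_lift, lift_fst]

theorem lift_whiskerRight_comp {Z A A' B C : X} (a : Z ⟶ A) (b : Z ⟶ B) (h : A ⟶ A')
    (f : A' ⊗ B ⟶ C) : lift a b ≫ (h ▷ B) ≫ f = lift (a ≫ h) b ≫ f := by
  rw [← Category.assoc, lift_whiskerRight]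

theorem lift_whiskerLeft_comp {Z A B B' C : X} (a : Z ⟶ A) (b : Z ⟶ B) (h : B ⟶ B')
    (f : A ⊗ B' ⟶ C) : lift a b ≫ (A ◁ h) ≫ f = lift a (b ≫ h) ≫ f := by
  rw [← Category.assoc, lift_whiskerLeft]

end products

variable {X : Type u} [Category.{v} X] [CartesianMonoidalCategory X]
  [CartesianLeftAdditiveCategory X]

open CartDiff.ReverseDifferentialCombinator (lift_add_lift lift_zero_zero)

/-! ### Additivity of linear maps and symmetry of second derivatives -/

namespace DifferentialCombinator

variable {𝒟 : DifferentialCombinator X}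

/-- Derivatives are additive in their direction, and linearity exhibits `f` at `⟨a, b⟩` as a
derivative at `⟨a, 0⟩` in direction `⟨0, b⟩`. -/
theorem IsLinearSnd.lift_add {A B C : X} {f : A ⊗ B ⟶ C} (hf : 𝒟.IsLinearSnd f) {Z : X}
    (a : Z ⟶ A) (b c : Z ⟶ B) : lift a (b + c) ≫ f = lift a b ≫ f + lift a c ≫ f := by
  rw [← hf a 0, ← hf a 0, ← hf a 0, ← 𝒟.lift_add_D, lift_add_lift, add_zero]

theorem IsLinearSnd.lift_zero {A B C : X} {f : A ⊗ B ⟶ C} (hf : 𝒟.IsLinearSnd f) {Z : X}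
    (a : Z ⟶ A) : lift a 0 ≫ f = 0 := by
  rw [← hf a 0, lift_zero_zero, 𝒟.lift_zero_D]

theorem IsLinearFst.lift_add {A B C : X} {f : A ⊗ B ⟶ C} (hf : 𝒟.IsLinearFst f) {Z : X}
    (a c : Z ⟶ A) (b : Z ⟶ B) : lift (a + c) b ≫ f = lift a b ≫ f + lift c b ≫ f := by
  rw [← hf 0 b, ← hf 0 b, ← hf 0 b, ← 𝒟.lift_add_D, lift_add_lift, add_zero]

theorem IsLinearFst.lift_zero {A B C : X} {f : A ⊗ B ⟶ C} (hf : 𝒟.IsLinearFst f) {Z : X}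
    (b : Z ⟶ B) : lift 0 b ≫ f = 0 := by
  rw [← hf 0 b, lift_zero_zero, 𝒟.lift_zero_D]

theorem zero_isLinearSnd (A B C : X) : 𝒟.IsLinearSnd (0 : A ⊗ B ⟶ C) := fun _ a b d => by
  rw [𝒟.lift_zero, comp_zero']

theorem IsLinearSnd.add {A B C : X} {f g : A ⊗ B ⟶ C} (hf : 𝒟.IsLinearSnd f)
    (hg : 𝒟.IsLinearSnd g) : 𝒟.IsLinearSnd (f + g) := fun _ a b d => by
  rw [𝒟.D_add, comp_add', comp_add', hf, hg]

theorem IsLinearSnd.prodLift {A B C E : X} {f : A ⊗ B ⟶ C} {g : A ⊗ B ⟶ E}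
    (hf : 𝒟.IsLinearSnd f) (hg : 𝒟.IsLinearSnd g) : 𝒟.IsLinearSnd (lift f g) :=
  fun _ a b d => by rw [𝒟.lift_lift, hf, hg, comp_lift]

variable (𝒟) in
/-- The full symmetry of second derivatives. -/
theorem D_D_exchange {Z A B : X} (f : A ⟶ B) (a b c d : Z ⟶ A) :
    lift (lift a b) (lift c d) ≫ 𝒟.D (𝒟.D f) = lift (lift a c) (lift b d) ≫ 𝒟.D (𝒟.D f) := by
  -- Additivity splits off the direction `⟨0, d⟩`; by [CD.6] its contribution does not involve `b`,
  -- so [CD.7] settles the rest.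
  have h (b c : Z ⟶ A) : lift (lift a b) (lift c d) ≫ 𝒟.D (𝒟.D f) =
      lift (lift a b) (lift c 0) ≫ 𝒟.D (𝒟.D f) + lift a d ≫ 𝒟.D f := by
    rw [← 𝒟.D_D_linear f a b d, ← 𝒟.lift_add_D, lift_add_lift, add_zero, zero_add]
  rw [h b c, h c b, 𝒟.D_D_symm]

end DifferentialCombinator

/-! ### From contextual daggers to reverse combinators -/

namespace ContextualLinearDagger

open DifferentialCombinator

variable {𝒟 : DifferentialCombinator X} (𝒹 : ContextualLinearDagger 𝒟)

theorem dag_congr {A B C : X} {f g : A ⊗ B ⟶ C} (h : f = g) (hf : 𝒟.IsLinearSnd f)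
    (hg : 𝒟.IsLinearSnd g) : 𝒹.dag f hf = 𝒹.dag g hg := by
  subst h; rfl

theorem dag_eq_comp {A B C E : X} {k : A ⊗ B ⟶ E} (hk : 𝒟.IsLinearSnd k) {f : A ⊗ B ⟶ C}
    {g : A ⊗ C ⟶ E} (hf : 𝒟.IsLinearSnd f) (hg : 𝒟.IsLinearSnd g)
    (h : k = lift (fst A B) f ≫ g) :
    𝒹.dag k hk = lift (fst A E) (𝒹.dag g hg) ≫ 𝒹.dag f hf := by
  rw [← 𝒹.dag_comp f g hf hg]; exact 𝒹.dag_congr h _ _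

theorem dag_eq_subst {A A' B C : X} {k : A' ⊗ B ⟶ C} (hk : 𝒟.IsLinearSnd k) {f : A ⊗ B ⟶ C}
    (hf : 𝒟.IsLinearSnd f) (h : A' ⟶ A) (e : k = (h ▷ B) ≫ f) :
    𝒹.dag k hk = (h ▷ C) ≫ 𝒹.dag f hf := by
  rw [← 𝒹.dag_subst f hf h]; exact 𝒹.dag_congr e _ _

theorem dag_eq_symm {A B C : X} {f : A ⊗ B ⟶ C} {g : A ⊗ C ⟶ B} (hf : 𝒟.IsLinearSnd f)
    (hg : 𝒟.IsLinearSnd g) (h : 𝒹.dag f hf = g) : 𝒹.dag g hg = f := by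
  subst h; exact 𝒹.dag_dag f hf

/-- Each component is the pairing followed by a projection, so its dagger is the dagger of the
pairing precomposed with an injection. The two injected components of an element add up to that
element. -/
theorem dag_lift {A B C E : X} {f : A ⊗ B ⟶ C} {g : A ⊗ B ⟶ E} (hf : 𝒟.IsLinearSnd f)
    (hg : 𝒟.IsLinearSnd g) : 𝒹.dag (lift f g) (hf.prodLift hg) =
      (A ◁ fst C E) ≫ 𝒹.dag f hf + (A ◁ snd C E) ≫ 𝒹.dag g hg := by
  have h₀ := 𝒹.dag_eq_comp hf (hf.prodLift hg) ((𝒟.fst_isLinear C E).snd_comp A) (by simp)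
  have h₁ := 𝒹.dag_eq_comp hg (hf.prodLift hg) ((𝒟.snd_isLinear C E).snd_comp A) (by simp)
  rw [𝒹.dag_fst] at h₀
  rw [𝒹.dag_snd] at h₁
  apply hom_ext_lift_elements
  intro Z a b
  rw [comp_add', h₀, h₁, lift_whiskerLeft_comp, lift_whiskerLeft_comp, lift_lift_fst_comp,
    lift_lift_fst_comp, lift_snd_assoc, lift_snd_assoc,
    ← (𝒹.dag_linear _ _).lift_add]
  congr 2
  ext <;> simp [inl, inr, add_fst, add_snd, comp_zero']

/-- The sum is the pairing `⟨f, g⟩` followed by the codiagonal. By `dag_lift` the diagonal has the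
codiagonal as its dagger, hence also conversely. -/
theorem dag_add {A B C : X} {f g : A ⊗ B ⟶ C} (hf : 𝒟.IsLinearSnd f)
    (hg : 𝒟.IsLinearSnd g) : 𝒹.dag (f + g) (hf.add hg) = 𝒹.dag f hf + 𝒹.dag g hg := by
  have hs := snd_isLinearSnd (𝒟 := 𝒟) A C
  have hc : 𝒟.IsLinearSnd (snd A (C ⊗ C) ≫ (fst C C + snd C C)) := by
    rw [comp_add']
    exact ((𝒟.fst_isLinear C C).snd_comp A).add ((𝒟.snd_isLinear C C).snd_comp A)
  have h := 𝒹.dag_eq_symm (hs.prodLift hs) hc (by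
    rw [𝒹.dag_lift hs hs, 𝒹.dag_id, comp_add', whiskerLeft_snd, whiskerLeft_snd])
  rw [𝒹.dag_eq_comp (hf.add hg) (hf.prodLift hg) hc (by simp [comp_add']), h, 𝒹.dag_lift hf hg]
  apply hom_ext_lift_elements
  intro Z a b
  rw [lift_lift_fst_comp]
  simp [comp_add', ← Category.assoc]

/-- Zero factors through the terminal object, and the dagger of its second factor lands there, so it
is zero too. -/
theorem dag_zero (A B C : X) : 𝒹.dag (0 : A ⊗ B ⟶ C) (zero_isLinearSnd A B C) = 0 := by
  rw [𝒹.dag_eq_comp (zero_isLinearSnd A B C) (zero_isLinearSnd A B (𝟙_ X))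
    (zero_isLinearSnd A (𝟙_ X) C) (comp_zero' _).symm,
    toUnit_unique (𝒹.dag (0 : A ⊗ 𝟙_ X ⟶ C) _) 0, (𝒹.dag_linear _ _).lift_zero]

/-- The second component of the dagger of the derivative recovers the dagger. -/
theorem dag_D_snd {A B C : X} (f : A ⊗ B ⟶ C) (hf : 𝒟.IsLinearSnd f) :
    𝒹.dag (𝒟.D f) (𝒟.D_isLinearSnd f) ≫ snd A B = (fst A B ▷ C) ≫ 𝒹.dag f hf := by
  have h := 𝒹.dag_eq_symm _ ((𝒟.inr_isLinear A B).snd_comp (A ⊗ B)) (𝒹.dag_snd (A ⊗ B) A B)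
  -- Linearity of `f`, read as a factorization in context `A ⊗ B`: inject into the second summand,
  -- then apply `D[f]`. Taking daggers turns the injection into `snd`.
  have e : (fst A B ▷ B) ≫ f =
      lift (fst (A ⊗ B) B) (snd (A ⊗ B) B ≫ inr A B) ≫ 𝒟.D f := by
    apply hom_ext_lift_elements
    intro Z a b
    rw [lift_whiskerRight_comp, lift_lift_fst_comp, lift_snd_assoc, inr, comp_lift, comp_zero',
      Category.comp_id, ← hf (a ≫ fst A B) (a ≫ snd A B)]
    congr 2
    ext <;> simp
  rw [← 𝒹.dag_subst, 𝒹.dag_eq_comp (hf.subst _) ((𝒟.inr_isLinear A B).snd_comp (A ⊗ B))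
    (𝒟.D_isLinearSnd f) e, h, lift_snd_assoc]

theorem lift_dag_D_snd {Z A B C : X} (f : A ⊗ B ⟶ C) (hf : 𝒟.IsLinearSnd f) (a : Z ⟶ A)
    (b : Z ⟶ B) (c : Z ⟶ C) :
    lift (lift a b) c ≫ 𝒹.dag (𝒟.D f) (𝒟.D_isLinearSnd f) ≫ snd A B =
      lift a c ≫ 𝒹.dag f hf := by
  rw [𝒹.dag_D_snd f hf, lift_whiskerRight_comp, lift_fst]

/-- The operator `R[f] = D[f]^†` of a Cartesian differential category with a contextual linear
dagger. -/
def revOp ⦃A B : X⦄ (f : A ⟶ B) : A ⊗ B ⟶ A := 𝒹.dag (𝒟.D f) (𝒟.D_isLinearSnd f)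

/-- `dag (D f)` is itself linear in its second argument, so `dag_D_snd` applies to it, and the
second component of `R[R[f]]` is the double dagger of `D f`. -/
theorem inducedD_revOp {A B : X} (f : A ⟶ B) : inducedD 𝒹.revOp f = 𝒟.D f := by
  apply hom_ext_lift_elements
  intro Z a b
  rw [inducedD, lift_whiskerRight_comp, inl, comp_lift, Category.comp_id, comp_zero']
  refine (𝒹.lift_dag_D_snd _ (𝒹.dag_linear _ _) a 0 b).trans ?_
  rw [𝒹.dag_dag]

/-- The reverse differential combinator of a contextual linear dagger. -/
def toReverse : ReverseDifferentialCombinator X where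
  R := 𝒹.revOp
  R_add f g := (𝒹.dag_congr (𝒟.D_add f g) _ _).trans (𝒹.dag_add _ _)
  R_zero A B := (𝒹.dag_congr (𝒟.D_zero A B) _ _).trans (𝒹.dag_zero _ _ _)
  lift_add_R f a b c := (𝒹.dag_linear _ _).lift_add a b c
  lift_zero_R f a := (𝒹.dag_linear _ _).lift_zero a
  R_id A := (𝒹.dag_congr (𝒟.D_id A) _ _).trans (𝒹.dag_id _ _)
  R_fst A B := (𝒹.dag_congr (𝒟.D_fst A B) _ _).trans (𝒹.dag_fst _ _ _)
  R_snd A B := (𝒹.dag_congr (𝒟.D_snd A B) _ _).trans (𝒹.dag_snd _ _ _)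
  R_lift f g := (𝒹.dag_congr (𝒟.D_lift f g) _ _).trans (𝒹.dag_lift _ _)
  R_comp {A B C} f g := by
    rw [revOp, 𝒹.dag_eq_comp _ (𝒟.D_isLinearSnd f) ((𝒟.D_isLinearSnd g).subst f), 𝒹.dag_subst]
    · rfl
    · apply hom_ext_lift_elements
      intro Z a b
      rw [𝒟.lift_comp, lift_lift_fst_comp, lift_whiskerRight_comp]
  R_linear f a b c := by
    rw [inducedD_revOp]
    exact 𝒹.dag_linear _ _ a b c
  R_symm f a b c d := by
    rw [inducedD_revOp, inducedD_revOp, 𝒟.D_D_exchange]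

theorem toReverse_toDiff : 𝒹.toReverse.toDiff = 𝒟 := by
  ext A B f
  exact 𝒹.inducedD_revOp f

end ContextualLinearDagger

/-! ### From reverse combinators to contextual daggers -/

namespace ReverseDifferentialCombinator

open DifferentialCombinator

variable (𝓡 : ReverseDifferentialCombinator X)

/-- The operator `f^†[A] = π₁ ∘ R[f] ∘ (⟨1, 0⟩ × 1)`. -/
def dagOp {A B C : X} (f : A ⊗ B ⟶ C) : A ⊗ C ⟶ B := (inl A B ▷ C) ≫ 𝓡.R f ≫ snd A B

theorem lift_dagOp {Z A B C : X} (f : A ⊗ B ⟶ C) (a : Z ⟶ A) (c : Z ⟶ C) :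
    lift a c ≫ 𝓡.dagOp f = lift (lift a 0) c ≫ 𝓡.R f ≫ snd A B := by
  rw [dagOp, lift_whiskerRight_comp, inl, comp_lift, Category.comp_id, comp_zero']

theorem dagOp_eq {A B C : X} (f : A ⊗ B ⟶ C) :
    𝓡.dagOp f = lift (lift (fst A C) 0) (snd A C) ≫ 𝓡.R f ≫ snd A B := by
  rw [← lift_dagOp, lift_fst_snd, Category.id_comp]

theorem dagOp_isLinearSnd {A B C : X} (f : A ⊗ B ⟶ C) : 𝓡.toDiff.IsLinearSnd (𝓡.dagOp f) := by
  intro Z a b d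
  rw [𝓡.lift_dagOp, 𝓡.dagOp_eq]
  simp only [𝓡.toDiff.lift_comp, 𝓡.toDiff.lift_lift, 𝓡.toDiff.lift_fst', 𝓡.toDiff.lift_snd',
    𝓡.toDiff.lift_zero, comp_lift, lift_fst, lift_snd, comp_zero']
  rw [lift_zero_zero, 𝓡.R_isLinearSnd, Category.assoc]

/-- Chain rule: reversing the final projection injects `b` as `⟨0, b⟩`, and reversing the embedding
`⟨⟨a, 0⟩, c⟩` keeps the component of `c` unchanged. -/
theorem lift_R_dagOp_snd {Z A B C : X} (f : A ⊗ B ⟶ C) (a : Z ⟶ A) (c : Z ⟶ C) (b : Z ⟶ B) :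
    lift (lift a c) b ≫ 𝓡.R (𝓡.dagOp f) ≫ snd A C =
      lift (lift (lift a 0) c) (lift 0 b) ≫ 𝓡.R (𝓡.R f) ≫ snd (A ⊗ B) C := by
  rw [𝓡.dagOp_eq]
  simp only [← Category.assoc, 𝓡.lift_comp, 𝓡.lift_lift, 𝓡.lift_fst', 𝓡.lift_snd', 𝓡.lift_zero,
    comp_lift, lift_fst, lift_snd, comp_zero', add_snd, add_zero, zero_add]

/-- By `lift_R_dagOp_snd` the double dagger is the induced derivative of `f` at `⟨a, 0⟩` in
direction `⟨0, b⟩`, which linearity identifies with `f`. -/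
theorem dagOp_dagOp {A B C : X} (f : A ⊗ B ⟶ C) (hf : 𝓡.toDiff.IsLinearSnd f) :
    𝓡.dagOp (𝓡.dagOp f) = f := by
  apply hom_ext_lift_elements
  intro Z a b
  rw [𝓡.lift_dagOp, 𝓡.lift_R_dagOp_snd, ← 𝓡.lift_inducedD]
  exact hf a 0 b

theorem dagOp_D {A B : X} (f : A ⟶ B) : 𝓡.dagOp (𝓡.toDiff.D f) = 𝓡.R f := by
  apply hom_ext_lift_elements
  intro Z a c
  refine Eq.trans ?_ (𝓡.R_isLinearSnd f a 0 c)
  refine Eq.trans ?_ (𝓡.lift_inducedD (𝓡.R f) _ _).symm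
  rw [𝓡.lift_dagOp]
  -- The induced `D f` is by definition `dagOp (R f)`, so this is the involution argument for `R f`.
  exact 𝓡.lift_R_dagOp_snd (𝓡.R f) a 0 c

/-- Linearity of `f` enters only through `f ∘ ⟨a, 0⟩ = 0`, which places the base point of `R[g]` at
`⟨a, 0⟩` as `dagOp g` requires. -/
theorem dagOp_comp {A B C E : X} (f : A ⊗ B ⟶ C) (g : A ⊗ C ⟶ E)
    (hf : 𝓡.toDiff.IsLinearSnd f) :
    𝓡.dagOp (lift (fst A B) f ≫ g) = lift (fst A E) (𝓡.dagOp g) ≫ 𝓡.dagOp f := by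
  apply hom_ext_lift_elements
  intro Z a e
  rw [lift_lift_fst_comp]
  simp only [𝓡.lift_dagOp, ← Category.assoc, 𝓡.lift_comp, 𝓡.lift_lift, 𝓡.lift_fst', comp_lift,
    lift_fst, lift_snd, add_snd, zero_add, hf.lift_zero]

theorem dagOp_subst {A A' B C : X} (f : A ⊗ B ⟶ C) (h : A' ⟶ A) :
    𝓡.dagOp ((h ▷ B) ≫ f) = (h ▷ C) ≫ 𝓡.dagOp f := by
  apply hom_ext_lift_elements
  intro Z a c
  rw [lift_whiskerRight_comp, whiskerRight_eq_lift]
  simp only [𝓡.lift_dagOp, ← Category.assoc, 𝓡.lift_comp, 𝓡.lift_lift, 𝓡.lift_fst', 𝓡.lift_snd',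
    comp_lift, lift_fst, lift_snd, add_snd, zero_add]

/-- The contextual linear dagger of a Cartesian reverse differential category. -/
def toDagger : ContextualLinearDagger 𝓡.toDiff where
  dag _ _ _ f _ := 𝓡.dagOp f
  dag_linear f _ := 𝓡.dagOp_isLinearSnd f
  dag_dag f hf := 𝓡.dagOp_dagOp f hf
  dag_id A B := by
    apply hom_ext_lift_elements
    intro Z a c
    rw [𝓡.lift_dagOp, ← Category.assoc, 𝓡.lift_snd', lift_snd, lift_snd]
  dag_comp f g hf _ := 𝓡.dagOp_comp f g hf
  dag_fst A B C := by
    apply hom_ext_lift_elements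
    intro Z a c
    rw [𝓡.lift_dagOp, ← Category.assoc, 𝓡.lift_comp, 𝓡.lift_snd', 𝓡.lift_fst', lift_snd,
      lift_snd_assoc, inl, comp_lift, Category.comp_id, comp_zero']
  dag_snd A B C := by
    apply hom_ext_lift_elements
    intro Z a c
    rw [𝓡.lift_dagOp, ← Category.assoc, 𝓡.lift_comp, 𝓡.lift_snd', 𝓡.lift_snd', lift_snd,
      lift_snd_assoc, inr, comp_lift, Category.comp_id, comp_zero']
  dag_subst f _ h := 𝓡.dagOp_subst f h

theorem R_eq_dag {A B : X} (f : A ⟶ B) :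
    𝓡.R f = 𝓡.toDagger.dag (𝓡.toDiff.D f) (𝓡.toDiff.D_isLinearSnd f) :=
  (𝓡.dagOp_D f).symm

/-- `dag_D_snd` at base point `⟨a, 0⟩` expresses any such dagger through `R`. -/
theorem eq_toDagger (𝒹 : ContextualLinearDagger 𝓡.toDiff)
    (h : ∀ {A B : X} (f : A ⟶ B), 𝓡.R f =
      𝒹.dag (𝓡.toDiff.D f) (𝓡.toDiff.D_isLinearSnd f)) : 𝒹 = 𝓡.toDagger := by
  ext A B C f hf
  apply hom_ext_lift_elements
  intro Z a c
  refine Eq.trans ?_ (𝓡.lift_dagOp f a c).symm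
  rw [h f, 𝒹.lift_dag_D_snd f hf]

end ReverseDifferentialCombinator

open DifferentialCombinator

/-! ### Linear currying, internal composition and automatic linearity -/

namespace LinearlyClosedCDC

variable (K : LinearlyClosedCDC X)

theorem curry_whiskerRight_ev {A B C : X} (f : A ⊗ B ⟶ C) (hf : K.diff.IsLinearSnd f) :
    (K.curry f hf ▷ B) ≫ K.ev B C = f :=
  (K.closed.existsUnique_curry f hf).choose_spec.1.symm

theorem lift_curry_ev {Z A B C : X} (f : A ⊗ B ⟶ C) (hf : K.diff.IsLinearSnd f) (a : Z ⟶ A)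
    (b : Z ⟶ B) : lift (a ≫ K.curry f hf) b ≫ K.ev B C = lift a b ≫ f := by
  rw [← lift_whiskerRight_comp, K.curry_whiskerRight_ev]

theorem eq_curry {A B C : X} {f : A ⊗ B ⟶ C} (hf : K.diff.IsLinearSnd f) {g : A ⟶ K.hom B C}
    (h : (g ▷ B) ≫ K.ev B C = f) : g = K.curry f hf :=
  (K.closed.existsUnique_curry f hf).choose_spec.2 g h.symm

theorem homExt {A B C : X} {g g' : A ⟶ K.hom B C}
    (h : ∀ ⦃Z : X⦄ (a : Z ⟶ A) (b : Z ⟶ B),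
      lift (a ≫ g) b ≫ K.ev B C = lift (a ≫ g') b ≫ K.ev B C) : g = g' := by
  have hf := (K.ev_isLinearSnd B C).subst g'
  rw [K.eq_curry hf rfl]
  apply K.eq_curry hf
  apply hom_ext_lift_elements
  intro Z a b
  rw [lift_whiskerRight_comp, lift_whiskerRight_comp, h]

theorem curry_congr {A B C : X} {f g : A ⊗ B ⟶ C} (h : f = g) (hf : K.diff.IsLinearSnd f)
    (hg : K.diff.IsLinearSnd g) : K.curry f hf = K.curry g hg := by
  subst h; rfl

theorem curry_ev (A B : X) : K.curry (K.ev A B) (K.ev_isLinearSnd A B) = 𝟙 _ :=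
  (K.eq_curry _ (by simp)).symm

theorem curry_subst {A A' B C : X} (f : A ⊗ B ⟶ C) (hf : K.diff.IsLinearSnd f) (h : A' ⟶ A) :
    K.curry ((h ▷ B) ≫ f) (hf.subst h) = h ≫ K.curry f hf :=
  (K.eq_curry _ (by rw [comp_whiskerRight, Category.assoc, K.curry_whiskerRight_ev])).symm

theorem curry_add {A B C : X} {f g : A ⊗ B ⟶ C} (hf : K.diff.IsLinearSnd f)
    (hg : K.diff.IsLinearSnd g) :
    K.curry (f + g) (hf.add hg) = K.curry f hf + K.curry g hg := by
  apply K.homExt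
  intro Z a b
  rw [comp_add', (K.closed.ev_bilinear B C).1.lift_add, lift_curry_ev, lift_curry_ev,
    lift_curry_ev, comp_add']

theorem curry_zero (A B C : X) :
    K.curry (0 : A ⊗ B ⟶ C) (zero_isLinearSnd A B C) = 0 := by
  apply K.homExt
  intro Z a b
  rw [comp_zero', (K.closed.ev_bilinear B C).1.lift_zero, lift_curry_ev, comp_zero']

theorem curry_snd_comp {B C : X} (f : B ⟶ C) (hf : K.diff.IsLinear f) (A : X) :
    K.curry (snd A B ≫ f) (hf.snd_comp A) = toUnit A ≫ K.point f hf := by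
  apply K.homExt
  intro Z a b
  rw [point, ← Category.assoc, lift_curry_ev, lift_curry_ev, lift_snd_assoc, lift_snd_assoc]

theorem lift_point_ev {Z A B : X} (f : A ⟶ B) (hf : K.diff.IsLinear f) (z : Z ⟶ 𝟙_ X)
    (a : Z ⟶ A) : lift (z ≫ K.point f hf) a ≫ K.ev A B = a ≫ f := by
  rw [point, lift_curry_ev, lift_snd_assoc]

theorem lift_compose_ev {Z A B C : X} (m : Z ⟶ K.hom B C) (l : Z ⟶ K.hom A B) (a : Z ⟶ A) :
    lift (lift m l ≫ K.compose A B C) a ≫ K.ev A C =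
      lift m (lift l a ≫ K.ev A B) ≫ K.ev B C := by
  rw [compose, lift_curry_ev, ← Category.assoc, lift_lift_associator_hom, ← Category.assoc,
    lift_whiskerLeft]

/-- Together with `curry_subst`, this translates dagger axioms into transpose axioms and yields the
chain rule for gradients. -/
theorem curry_comp {A B C E : X} {f : A ⊗ B ⟶ C} {g : A ⊗ C ⟶ E} (hf : K.diff.IsLinearSnd f)
    (hg : K.diff.IsLinearSnd g) : K.curry (lift (fst A B) f ≫ g) (hf.comp hg) =
      lift (K.curry g hg) (K.curry f hf) ≫ K.compose B C E := by
  apply K.homExt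
  intro Z a b
  rw [← Category.assoc, comp_lift, lift_compose_ev, lift_curry_ev, lift_curry_ev, lift_curry_ev,
    lift_lift_fst_comp]

theorem compose_assoc {Z A B C E : X} (n : Z ⟶ K.hom C E) (m : Z ⟶ K.hom B C)
    (l : Z ⟶ K.hom A B) :
    lift (lift n m ≫ K.compose B C E) l ≫ K.compose A B E =
      lift n (lift m l ≫ K.compose A B C) ≫ K.compose A C E := by
  apply K.homExt
  intro W w a
  simp only [← Category.assoc, comp_lift, lift_compose_ev]

theorem point_id_compose {Z A B : X} (z : Z ⟶ 𝟙_ X) (l : Z ⟶ K.hom A B) :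
    lift (z ≫ K.point (𝟙 B) (K.diff.id_isLinear B)) l ≫ K.compose A B B = l := by
  apply K.homExt
  intro W w a
  rw [← Category.assoc, comp_lift, lift_compose_ev, ← Category.assoc, lift_point_ev,
    Category.comp_id]

theorem compose_point_id {Z A B : X} (z : Z ⟶ 𝟙_ X) (l : Z ⟶ K.hom A B) :
    lift l (z ≫ K.point (𝟙 A) (K.diff.id_isLinear A)) ≫ K.compose A A B = l := by
  apply K.homExt
  intro W w a
  rw [← Category.assoc, comp_lift, lift_compose_ev, ← Category.assoc, lift_point_ev,
    Category.comp_id]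

/-- Reduces the derivative of a map into an internal hom to that of its uncurried form, so that
bilinearity of composition can be tested on evaluations. -/
theorem lift_D_ev {Z A B C : X} (g : A ⟶ K.hom B C) (a c : Z ⟶ A) (b : Z ⟶ B) :
    lift (lift a c ≫ K.diff.D g) b ≫ K.ev B C =
      lift (lift a b) (lift c 0) ≫ K.diff.D ((g ▷ B) ≫ K.ev B C) := by
  rw [whiskerRight_eq_lift, K.diff.lift_comp, K.diff.lift_lift, K.diff.lift_comp,
    K.diff.lift_fst', K.diff.lift_snd', comp_lift, lift_snd, lift_snd, lift_fst, lift_fst_assoc, lift_fst,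
    (K.closed.ev_bilinear B C).1]

theorem compose_whiskerRight_ev (A B C : X) : (K.compose A B C ▷ A) ≫ K.ev A C =
    lift (fst (K.hom B C ⊗ K.hom A B) A ≫ fst _ _)
      (lift (fst (K.hom B C ⊗ K.hom A B) A ≫ snd _ _) (snd _ _) ≫ K.ev A B) ≫ K.ev B C := by
  rw [← K.lift_compose_ev, ← comp_lift, lift_fst_snd, Category.comp_id, whiskerRight_eq_lift]

theorem compose_bilinear (A B C : X) : K.diff.IsBilinear (K.compose A B C) := by
  constructor
  all_goals
    intro Z m l m'
    apply K.homExt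
    intro W w a
    rw [← Category.assoc, ← Category.assoc, comp_lift, lift_D_ev, compose_whiskerRight_ev]
    simp only [K.diff.lift_comp, K.diff.lift_lift, K.diff.lift_fst', K.diff.lift_snd', comp_lift,
      lift_fst, lift_snd, comp_zero', lift_compose_ev, ← Category.assoc]
  · rw [lift_zero_zero, K.diff.lift_zero_D, (K.closed.ev_bilinear B C).1]
  · rw [(K.closed.ev_bilinear A B).1, (K.closed.ev_bilinear B C).2]

/-- An involution of the internal homs which preserves zero and reverses composition is linear. -/
theorem isLinear_of_antiinvolution (tr : ∀ A B : X, K.hom A B ⟶ K.hom B A)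
    (tr_tr : ∀ A B : X, tr A B ≫ tr B A = 𝟙 (K.hom A B))
    (zero_tr : ∀ Z A B : X, (0 : Z ⟶ K.hom A B) ≫ tr A B = 0)
    (compose_tr : ∀ A B C : X, K.compose A B C ≫ tr A C =
      lift (snd (K.hom B C) (K.hom A B) ≫ tr A B) (fst (K.hom B C) (K.hom A B) ≫ tr B C) ≫
        K.compose C B A) (A B : X) : K.diff.IsLinear (tr A B) := by
  have compose_fst {Z A B C : X} (m : Z ⟶ K.hom B C) (l : Z ⟶ K.hom A B) :
      lift 0 (lift m l ≫ K.compose A B C) ≫ K.diff.D (tr A C) =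
        lift (l ≫ tr A B) (lift 0 m ≫ K.diff.D (tr B C)) ≫ K.compose C B A := by
    -- At the base point `(0, l)`, moving only the first factor: composition with zero vanishes, so
    -- both transposes that get differentiated nontrivially are based at zero.
    have h := congrArg (fun t => lift (lift 0 l) (lift m 0) ≫ K.diff.D t) (compose_tr A B C)
    simpa only [K.diff.lift_comp, K.diff.lift_lift, K.diff.lift_fst', K.diff.lift_snd', lift_fst,
      lift_snd, comp_lift, lift_fst_assoc, lift_snd_assoc, K.diff.lift_zero_D, zero_tr,
      (K.compose_bilinear A B C).1.lift_zero, (K.compose_bilinear A B C).1 0 l m,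
      (K.compose_bilinear C B A).2 _ 0 _] using h
  have compose_snd {Z A B C : X} (m : Z ⟶ K.hom B C) (l : Z ⟶ K.hom A B) :
      lift 0 (lift m l ≫ K.compose A B C) ≫ K.diff.D (tr A C) =
        lift (lift 0 l ≫ K.diff.D (tr A B)) (m ≫ tr B C) ≫ K.compose C B A := by
    have h := congrArg (fun t => lift (lift m 0) (lift 0 l) ≫ K.diff.D t) (compose_tr A B C)
    simpa only [K.diff.lift_comp, K.diff.lift_lift, K.diff.lift_fst', K.diff.lift_snd', lift_fst,
      lift_snd, comp_lift, lift_fst_assoc, lift_snd_assoc, K.diff.lift_zero_D, zero_tr,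
      (K.compose_bilinear A B C).2.lift_zero, (K.compose_bilinear A B C).2 m 0 l,
      (K.compose_bilinear C B A).1 0 _ _] using h
  have D_tr_D_tr {Z A B : X} (l : Z ⟶ K.hom A B) :
      lift 0 (lift 0 l ≫ K.diff.D (tr A B)) ≫ K.diff.D (tr B A) = l := by
    have h := congrArg (fun t => lift 0 l ≫ K.diff.D t) (tr_tr A B)
    simpa only [K.diff.lift_comp, zero_tr, K.diff.lift_id] using h
  let i (Z B : X) : Z ⟶ K.hom B B := toUnit Z ≫ K.point (𝟙 B) (K.diff.id_isLinear B)
  -- The derivative of the transpose at zero, applied to the identity. It is a constant, stable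
  -- under change of `Z`, with right inverse its own transpose.
  let u (Z B : X) : Z ⟶ K.hom B B := lift 0 (i Z B) ≫ K.diff.D (tr B B)
  have comp_i {W Z B : X} (w : W ⟶ Z) : w ≫ i Z B = i W B := by
    simp only [i, ← Category.assoc, comp_toUnit]
  have comp_u {W Z B : X} (w : W ⟶ Z) : w ≫ u Z B = u W B := by
    simp only [u, ← Category.assoc, comp_lift, comp_zero', comp_i]
  have u_inv (Z B : X) : lift (u Z B) (u Z B ≫ tr B B) ≫ K.compose B B B = i Z B := by
    have h := compose_snd (u Z B) (i Z B)
    rw [K.compose_point_id, D_tr_D_tr] at h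
    exact h.symm
  have tr_eq {Z A B : X} (l : Z ⟶ K.hom A B) : l ≫ tr A B =
      lift (lift 0 l ≫ K.diff.D (tr A B)) (u Z B ≫ tr B B) ≫ K.compose B B A := by
    have h := compose_fst (i Z B) l
    rw [K.point_id_compose] at h
    rw [h, K.compose_assoc, u_inv, K.compose_point_id]
  intro Z a b
  -- The universal instance of `tr_eq`, with the factor `u ≫ tr B B` routed through the terminal
  -- object so that its derivative vanishes.
  have e : tr A B = lift (lift 0 (𝟙 _) ≫ K.diff.D (tr A B))
      (toUnit _ ≫ u (𝟙_ X) B ≫ tr B B) ≫ K.compose B B A := by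
    rw [← Category.assoc, comp_u, ← tr_eq, Category.id_comp]
  conv_lhs => rw [e]
  rw [K.diff.lift_comp, K.diff.lift_lift, K.diff.lift_comp (lift 0 _), K.diff.lift_lift,
    K.diff.lift_zero, K.diff.lift_id, K.diff.lift_comp (toUnit _),
    toUnit_unique (lift a b ≫ K.diff.D (toUnit _)) 0, K.diff.lift_zero_D]
  simp only [comp_lift, comp_zero', Category.comp_id]
  rw [(K.compose_bilinear B B A).1]
  simp only [← Category.assoc, comp_u]
  -- The other factor is the derivative of `tr` at zero, linear in its direction by [CD.6].
  rw [K.diff.D_D_linear, ← tr_eq]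

variable {K}

/-- `f` is the change of context of evaluation along its curry, and daggers commute with change of
context. -/
theorem curry_dag (𝒹 : ContextualLinearDagger K.diff) {A B C : X} (f : A ⊗ B ⟶ C)
    (hf : K.diff.IsLinearSnd f) : K.curry (𝒹.dag f hf) (𝒹.dag_linear f hf) =
      K.curry f hf ≫ K.curry (𝒹.dag (K.ev B C) (K.ev_isLinearSnd B C)) (𝒹.dag_linear _ _) := by
  rw [← K.curry_subst]
  exact K.curry_congr (𝒹.dag_eq_subst hf _ _ (K.curry_whiskerRight_ev f hf).symm) _ _

end LinearlyClosedCDC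

/-! ### Contextual daggers and linear transposes -/

open LinearlyClosedCDC

variable {K : LinearlyClosedCDC X}

/-- The linear transpose of a contextual linear dagger. -/
noncomputable def ContextualLinearDagger.toTranspose (𝒹 : ContextualLinearDagger K.diff) :
    LinearTranspose K :=
  let tr (A B : X) : K.hom A B ⟶ K.hom B A :=
    K.curry (𝒹.dag (K.ev A B) (K.ev_isLinearSnd A B)) (𝒹.dag_linear _ _)
  have curry_tr {A B C : X} (f : A ⊗ B ⟶ C) (hf : K.diff.IsLinearSnd f) :
      K.curry f hf ≫ tr B C = K.curry (𝒹.dag f hf) (𝒹.dag_linear f hf) :=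
    (curry_dag 𝒹 f hf).symm
  have tr_tr (A B : X) : tr A B ≫ tr B A = 𝟙 (K.hom A B) := by
    rw [← K.curry_ev]
    exact (curry_tr _ _).trans (K.curry_congr (𝒹.dag_dag _ _) _ _)
  have zero_tr (Z A B : X) : (0 : Z ⟶ K.hom A B) ≫ tr A B = 0 := by
    rw [← K.curry_zero, ← K.curry_zero]
    exact (curry_tr _ _).trans (K.curry_congr (𝒹.dag_zero _ _ _) _ _)
  have compose_tr (A B C : X) : K.compose A B C ≫ tr A C =
      lift (snd (K.hom B C) (K.hom A B) ≫ tr A B) (fst (K.hom B C) (K.hom A B) ≫ tr B C) ≫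
        K.compose C B A := by
    have hf := (K.ev_isLinearSnd A B).subst (snd (K.hom B C) (K.hom A B))
    have hg := (K.ev_isLinearSnd B C).subst (fst (K.hom B C) (K.hom A B))
    -- Internal composition is the curry of two evaluations composed in context `L(B, C) × L(A, B)`,
    -- so its transpose is governed by `dag_comp`.
    have e := K.curry_comp hf hg
    rw [K.curry_subst _ (K.ev_isLinearSnd B C), K.curry_subst _ (K.ev_isLinearSnd A B), K.curry_ev,
      K.curry_ev, Category.comp_id, Category.comp_id, lift_fst_snd, Category.id_comp] at e
    rw [← e, curry_tr, ← K.curry_subst, ← K.curry_subst, ← K.curry_comp]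
    apply K.curry_congr
    rw [𝒹.dag_comp _ _ hf hg, 𝒹.dag_subst, 𝒹.dag_subst]
  { tr := tr
    tr_linear := K.isLinear_of_antiinvolution tr tr_tr zero_tr compose_tr
    tr_tr := tr_tr
    point_id_tr A := (curry_tr _ _).trans (K.curry_congr
      ((𝒹.dag_congr (Category.comp_id _) _ _).trans
        ((𝒹.dag_id _ _).trans (Category.comp_id _).symm)) _ _)
    point_fst_tr A B := (curry_tr _ _).trans (K.curry_congr (𝒹.dag_fst _ _ _) _ _)
    point_snd_tr A B := (curry_tr _ _).trans (K.curry_congr (𝒹.dag_snd _ _ _) _ _)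
    compose_tr := compose_tr }

namespace LinearTranspose

variable (τ : LinearTranspose K)

/-- The operator `f^†[A] = ε ∘ (τ × 1) ∘ (λ(f) × 1)`. -/
noncomputable def dagOp {A B C : X} (f : A ⊗ B ⟶ C) (hf : K.diff.IsLinearSnd f) : A ⊗ C ⟶ B :=
  (K.curry f hf ▷ C) ≫ (τ.tr B C ▷ C) ≫ K.ev C B

theorem dagOp_isLinearSnd {A B C : X} (f : A ⊗ B ⟶ C) (hf : K.diff.IsLinearSnd f) :
    K.diff.IsLinearSnd (τ.dagOp f hf) :=
  ((K.ev_isLinearSnd C B).subst _).subst _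

/-- Reduces each dagger axiom to an identity between curries, where the transpose axioms apply. -/
theorem dagOp_eq {A B C : X} {f : A ⊗ B ⟶ C} (hf : K.diff.IsLinearSnd f) {g : A ⊗ C ⟶ B}
    (hg : K.diff.IsLinearSnd g) (h : K.curry f hf ≫ τ.tr B C = K.curry g hg) :
    τ.dagOp f hf = g := by
  rw [← K.curry_whiskerRight_ev g hg, ← h, dagOp, comp_whiskerRight, Category.assoc]

theorem curry_dagOp {A B C : X} (f : A ⊗ B ⟶ C) (hf : K.diff.IsLinearSnd f) :
    K.curry (τ.dagOp f hf) (τ.dagOp_isLinearSnd f hf) = K.curry f hf ≫ τ.tr B C :=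
  (K.eq_curry _ (by rw [dagOp, comp_whiskerRight, Category.assoc])).symm

/-- The contextual linear dagger of a linear transpose. -/
noncomputable def toDagger : ContextualLinearDagger K.diff where
  dag _ _ _ f hf := τ.dagOp f hf
  dag_linear := τ.dagOp_isLinearSnd
  dag_dag f hf := τ.dagOp_eq _ hf (by
    rw [τ.curry_dagOp, Category.assoc, τ.tr_tr, Category.comp_id])
  dag_id A B := τ.dagOp_eq _ (snd_isLinearSnd A B) (by
    have e : K.curry (snd A B) (snd_isLinearSnd A B) =
        toUnit A ≫ K.point (𝟙 B) (K.diff.id_isLinear B) := by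
      rw [← K.curry_snd_comp]
      exact K.curry_congr (Category.comp_id _).symm _ _
    rw [e, Category.assoc, τ.point_id_tr])
  dag_comp f g hf hg := τ.dagOp_eq _ ((τ.dagOp_isLinearSnd g hg).comp (τ.dagOp_isLinearSnd f hf))
    (by rw [K.curry_comp hf hg, K.curry_comp (τ.dagOp_isLinearSnd g hg) (τ.dagOp_isLinearSnd f hf),
      τ.curry_dagOp, τ.curry_dagOp, Category.assoc, τ.compose_tr, ← Category.assoc, comp_lift,
      lift_fst_assoc, lift_snd_assoc])
  dag_fst A B C := τ.dagOp_eq _ ((K.diff.inl_isLinear B C).snd_comp A) (by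
    rw [K.curry_snd_comp _ (K.diff.fst_isLinear B C), K.curry_snd_comp, Category.assoc,
      τ.point_fst_tr])
  dag_snd A B C := τ.dagOp_eq _ ((K.diff.inr_isLinear B C).snd_comp A) (by
    rw [K.curry_snd_comp _ (K.diff.snd_isLinear B C), K.curry_snd_comp, Category.assoc,
      τ.point_snd_tr])
  dag_subst f hf h := τ.dagOp_eq _ ((τ.dagOp_isLinearSnd f hf).subst h) (by
    rw [K.curry_subst _ hf, K.curry_subst _ (τ.dagOp_isLinearSnd f hf), τ.curry_dagOp, Category.assoc])

end LinearTranspose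

variable (K) in
/-- Contextual linear daggers are the same as linear transposes. -/
noncomputable def daggerEquivTranspose :
    ContextualLinearDagger K.diff ≃ LinearTranspose K where
  toFun 𝒹 := 𝒹.toTranspose
  invFun τ := τ.toDagger
  left_inv 𝒹 := by
    ext A B C f hf
    exact 𝒹.toTranspose.dagOp_eq hf (𝒹.dag_linear f hf) (curry_dag 𝒹 f hf).symm
  right_inv τ := by
    ext A B
    refine (τ.curry_dagOp _ _).trans ?_
    rw [K.curry_ev, Category.id_comp]

theorem ContextualLinearDagger.dag_eq_transpose (𝒹 : ContextualLinearDagger K.diff) {A B C : X}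
    (f : A ⊗ B ⟶ C) (hf : K.diff.IsLinearSnd f) :
    𝒹.dag f hf = (K.curry f hf ▷ C) ≫ (𝒹.toTranspose.tr B C ▷ C) ≫ K.ev C B :=
  (𝒹.toTranspose.dagOp_eq hf (𝒹.dag_linear f hf) (curry_dag 𝒹 f hf).symm).symm

/-! ### The bijection of structures and the gradient laws -/

namespace LinearlyClosedCRDC

variable (S : LinearlyClosedCRDC X)

/-- The contextual linear dagger of a linearly closed Cartesian reverse differential category. -/
def dagger : ContextualLinearDagger S.toCDC.diff := S.rev.toDagger

/-- The linear transpose of a linearly closed Cartesian reverse differential category. -/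
noncomputable def transpose : LinearTranspose S.toCDC := S.dagger.toTranspose

theorem R_eq_transpose {A B : X} (f : A ⟶ B) : S.rev.R f =
    (S.toCDC.jacobian f ▷ B) ≫ (S.transpose.tr A B ▷ B) ≫ S.toCDC.ev B A :=
  (S.rev.R_eq_dag f).trans (S.dagger.dag_eq_transpose _ _)

theorem toCDC_transpose_injective : Function.Injective (fun S : LinearlyClosedCRDC X =>
    (⟨S.toCDC, S.transpose⟩ : Σ K : LinearlyClosedCDC X, LinearTranspose K)) := by
  intro S T h
  have hR : S.rev = T.rev := by
    ext A B f
    rw [S.R_eq_transpose, T.R_eq_transpose]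
    -- The recovery formula is a function of the whole pair, so no transport between the two
    -- transposes is needed.
    exact congrArg (fun P : Σ K : LinearlyClosedCDC X, LinearTranspose K =>
      (P.1.jacobian f ▷ B) ≫ (P.2.tr A B ▷ B) ≫ P.1.ev B A) h
  have hK : S.toCDC = T.toCDC := congrArg Sigma.fst h
  obtain ⟨r, c⟩ := S
  obtain ⟨r', c'⟩ := T
  obtain rfl : r = r' := hR
  simp only [toCDC, LinearlyClosedCDC.mk.injEq, heq_eq_eq, true_and] at hK
  rw [hK]

/-- The differential combinator is kept as a variable, equal to the induced one only by hypothesis,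
so that substitution replaces transport of the closed structure and the dagger. -/
theorem exists_of_dagger {𝒟 : DifferentialCombinator X} (c : LinearlyClosedStructure 𝒟)
    (𝒹 : ContextualLinearDagger 𝒟) (𝓡 : ReverseDifferentialCombinator X) (h : 𝓡.toDiff = 𝒟)
    (hR : ∀ {A B : X} (f : A ⟶ B), 𝓡.R f = 𝒹.dag (𝒟.D f) (𝒟.D_isLinearSnd f)) :
    ∃ S : LinearlyClosedCRDC X,
      (⟨S.toCDC, S.transpose⟩ : Σ K : LinearlyClosedCDC X, LinearTranspose K) =
        ⟨⟨𝒟, c⟩, ContextualLinearDagger.toTranspose (K := ⟨𝒟, c⟩) 𝒹⟩ := by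
  subst h
  obtain rfl := 𝓡.eq_toDagger 𝒹 hR
  exact ⟨⟨𝓡, c⟩, rfl⟩

theorem toCDC_transpose_surjective : Function.Surjective (fun S : LinearlyClosedCRDC X =>
    (⟨S.toCDC, S.transpose⟩ : Σ K : LinearlyClosedCDC X, LinearTranspose K)) := by
  rintro ⟨⟨𝒟, c⟩, τ⟩
  obtain ⟨S, hS⟩ := exists_of_dagger c τ.toDagger τ.toDagger.toReverse
    τ.toDagger.toReverse_toDiff (fun _ => rfl)
  refine ⟨S, hS.trans ?_⟩
  congr 1
  exact (daggerEquivTranspose ⟨𝒟, c⟩).apply_symm_apply τ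

theorem gradient_eq {A B : X} (f : A ⟶ B) :
    S.gradient f = S.toCDC.jacobian f ≫ S.transpose.tr A B :=
  (S.toCDC.curry_congr (S.rev.R_eq_dag f) _ _).trans (curry_dag S.dagger _ _)

theorem gradient_add {A B : X} (f g : A ⟶ B) :
    S.gradient (f + g) = S.gradient f + S.gradient g :=
  (S.toCDC.curry_congr (S.rev.R_add f g) _ _).trans (S.toCDC.curry_add _ _)

theorem gradient_zero (A B : X) : S.gradient (0 : A ⟶ B) = 0 :=
  (S.toCDC.curry_congr (S.rev.R_zero A B) _ _).trans (S.toCDC.curry_zero _ _ _)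

/-- The derivative of a linear map ignores its base point, hence comes from the terminal context,
and so does its dagger. -/
theorem gradient_linear {A B : X} (f : A ⟶ B) (hf : S.toCDC.diff.IsLinear f) :
    S.gradient f = (0 : A ⟶ 𝟙_ X) ≫
      S.toCDC.point (S.dagger.linDag f hf) (S.dagger.linDag_isLinear f hf) := by
  rw [toUnit_unique (0 : A ⟶ 𝟙_ X) (toUnit A), ← S.toCDC.curry_snd_comp]
  apply S.toCDC.curry_congr
  have e : S.toCDC.diff.D f = (toUnit A ▷ A) ≫ snd (𝟙_ X) A ≫ f := by
    apply hom_ext_lift_elements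
    intro Z a b
    rw [hf, lift_whiskerRight_comp, lift_snd_assoc]
  refine (S.rev.R_eq_dag f).trans
    ((S.dagger.dag_eq_subst (S.toCDC.diff.D_isLinearSnd f) (hf.snd_comp _) _ e).trans ?_)
  apply hom_ext_lift_elements
  intro Z a b
  rw [lift_whiskerRight_comp, lift_snd_assoc, ContextualLinearDagger.linDag, ← Category.assoc,
    comp_lift, Category.comp_id, comp_toUnit, comp_toUnit]

/-- [RD.5] presents `R[g ∘ f]` as a composite in context `A`: `R[g]` pulled back along `f`, followed
by `R[f]`. -/
theorem gradient_comp {A B C : X} (f : A ⟶ B) (g : B ⟶ C) : S.gradient (f ≫ g) =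
    lift (S.gradient f) (f ≫ S.gradient g) ≫ S.toCDC.compose C B A := by
  refine (S.toCDC.curry_congr (S.rev.R_comp f g) _ _).trans
    ((S.toCDC.curry_comp ((S.rev.R_isLinearSnd g).subst f) (S.rev.R_isLinearSnd f)).trans ?_)
  rw [S.toCDC.curry_subst _ (S.rev.R_isLinearSnd g)]
  rfl

end LinearlyClosedCRDC

end CartDiff

theorem mainTheorem1 {X : Type u} [Category.{v} X] [CartesianMonoidalCategory X]
    [CartesianLeftAdditiveCategory X] :
    -- on a linearly closed Cartesian differential category, contextual linear daggers and linear
    -- transposes determine each other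
    (∀ K : LinearlyClosedCDC X, ∃ e : ContextualLinearDagger K.diff ≃ LinearTranspose K,
      (∀ (𝒹 : ContextualLinearDagger K.diff) (A B : X),
        (e 𝒹).tr A B =
          K.curry (𝒹.dag (K.ev A B) (K.ev_isLinearSnd A B)) (𝒹.dag_linear _ _)) ∧
      (∀ (τ : LinearTranspose K) {A B C : X} (f : A ⊗ B ⟶ C) (hf : K.diff.IsLinearSnd f),
        (e.symm τ).dag f hf = (K.curry f hf ▷ C) ≫ (τ.tr B C ▷ C) ≫ K.ev C B)) ∧
    -- the contextual linear dagger and the linear transpose of a linearly closed Cartesian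
    -- reverse differential category
    ∃ (dagger : ∀ S : LinearlyClosedCRDC X, ContextualLinearDagger S.toCDC.diff)
      (τ : ∀ S : LinearlyClosedCRDC X, LinearTranspose S.toCDC),
      Function.Bijective (fun S : LinearlyClosedCRDC X =>
        (⟨S.toCDC, τ S⟩ : Σ K : LinearlyClosedCDC X, LinearTranspose K)) ∧
      ∀ S : LinearlyClosedCRDC X,
        -- `dagger S` is the contextual linear dagger with `R[f] = D[f]^†[A]`
        (∀ {A B : X} (f : A ⟶ B), S.rev.R f =
          (dagger S).dag (S.toCDC.diff.D f) (S.toCDC.diff.D_isLinearSnd f)) ∧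
        (∀ 𝒹 : ContextualLinearDagger S.toCDC.diff,
          (∀ {A B : X} (f : A ⟶ B), S.rev.R f =
            𝒹.dag (S.toCDC.diff.D f) (S.toCDC.diff.D_isLinearSnd f)) → 𝒹 = dagger S) ∧
        -- `τ S` is the linear curry of the dagger of evaluation
        (∀ A B : X, (τ S).tr A B =
          S.toCDC.curry ((dagger S).dag (S.toCDC.ev A B) (S.toCDC.ev_isLinearSnd A B))
            ((dagger S).dag_linear _ _)) ∧
        -- the reverse derivative is recovered from the derivative and the transpose
        (∀ {A B : X} (f : A ⟶ B), S.rev.R f =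
          (S.toCDC.jacobian f ▷ B) ≫ ((τ S).tr A B ▷ B) ≫ S.toCDC.ev B A) ∧
        -- (i)
        (∀ {A B C : X} (f : A ⊗ B ⟶ C) (hf : S.toCDC.diff.IsLinearSnd f),
          (dagger S).dag f hf = (S.toCDC.curry f hf ▷ C) ≫
            (dagger S).dag (S.toCDC.ev B C) (S.toCDC.ev_isLinearSnd B C)) ∧
        -- (ii)
        (∀ {A B C : X} (f : A ⊗ B ⟶ C) (hf : S.toCDC.diff.IsLinearSnd f),
          S.toCDC.curry ((dagger S).dag f hf) ((dagger S).dag_linear f hf) =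
            S.toCDC.curry f hf ≫ (τ S).tr B C) ∧
        -- (iii)
        (∀ {A B : X} (f : A ⟶ B), S.gradient f = S.toCDC.jacobian f ≫ (τ S).tr A B) ∧
        -- (iv)
        (∀ {A B : X} (f g : A ⟶ B), S.gradient (f + g) = S.gradient f + S.gradient g) ∧
        (∀ A B : X, S.gradient (0 : A ⟶ B) = 0) ∧
        -- (v)
        (∀ {A B : X} (f : A ⟶ B) (hf : S.toCDC.diff.IsLinear f), S.gradient f =
          (0 : A ⟶ 𝟙_ X) ≫ S.toCDC.point ((dagger S).linDag f hf)
            ((dagger S).linDag_isLinear f hf)) ∧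
        -- (vi)
        (∀ {A B C : X} (f : A ⟶ B) (g : B ⟶ C), S.gradient (f ≫ g) =
          lift (S.gradient f) (f ≫ S.gradient g) ≫ S.toCDC.compose C B A) := by
  refine ⟨fun K => ⟨daggerEquivTranspose K, fun _ _ _ => rfl, fun _ _ _ _ _ _ => rfl⟩,
    fun S => S.dagger, fun S => S.transpose,
    ⟨LinearlyClosedCRDC.toCDC_transpose_injective, LinearlyClosedCRDC.toCDC_transpose_surjective⟩,
    fun S => ⟨fun f => S.rev.R_eq_dag f, fun 𝒹 h => S.rev.eq_toDagger 𝒹 h, fun _ _ => rfl,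
      fun f => S.R_eq_transpose f, fun f hf => ?_,
      fun f hf => LinearlyClosedCDC.curry_dag S.dagger f hf, fun f => S.gradient_eq f,
      fun f g => S.gradient_add f g, S.gradient_zero, fun f hf => S.gradient_linear f hf,
      fun f g => S.gradient_comp f g⟩⟩
  exact S.dagger.dag_eq_subst hf _ _ (S.toCDC.curry_whiskerRight_ev f hf).symm
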